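/- Let $n\ge 3$. An integral frieze pattern of width $n$ is a family of integers $F(i,j)$, $i,j\in\mathbb Z$, $0\le j-i\le n$, with $F(i,i)=F(i,i+n)=0$, $F(i,i+1)=F(i,i+n-1)=1$ for all $i$, and $$F(i-1,j)F(i,j+1)-F(i,j)F(i-1,j+1)=1$$ whenever $i\le j$ and all four entries are defined; it is positive if $F(i,j)>0$ for $0<j-i<n$. An infinite frieze pattern is a family $G(i,j)$, $0\le j-i$, with $G(i,i)=0$, $G(i,i+1)=1$ and the same rule for all $i\le j$; it is tame if $\det\big(G(i+a,j+b)\big)_{0\le a,b\le 2}=0$ whenever $i+2\le j$. If $d$ is the minimal period of its quiddity row $i\mapsto G(i,i+2)$ and $G(i,i+d+1)-G(i+1,i+d)$ does not depend on $i$, this constant is the principal growth coefficient of $G$. Let $F$ be a positive integral frieze pattern of width $n$, and let $T$ be the corresponding triangulation of the $n$-gon with vertices $v_0,\dots,v_{n-1}$ (in cyclic order, indices modulo $n$); that is, $F(i-1,i+1)$ is the number of triangles of $T$ incident to $v_i$, for every $i\in\mathbb Z$. Then $F$ extends to a unique tame infinite integral frieze pattern, whose quiddity row is periodic and whose principal growth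 coefficient, called the principal growth coefficient of $F$, is well defined. This coefficient belongs to $\{-2,0,1\}$, and 1. it is $-2$ if and only if $T$ has no nontrivial rotational symmetry (no rotation of the $n$-gon other than the identity preserves $T$); 2. it is $0$ if and only if $T$ has $2$-fold rotational symmetry ($2\mid n$ and $T$ is preserved by $v_i\mapsto v_{i+n/2}$); 3. it is $1$ if and only if $T$ has $3$-fold rotational symmetry ($3\mid n$ and $T$ is preserved by $v_i\mapsto v_{i+n/3}$). -/

import Mathlib

namespace Frieze

/-! ### Frieze patterns

A (finite or infinite) frieze pattern is represented by a function of two integer variables.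
Only its values `F i j` with `0 ≤ j - i ≤ n` (finite case, width `n`), respectively `0 ≤ j - i`
(infinite case), are meaningful. -/

/-- `F` is a frieze pattern of width `n` with integer entries `F i j`, `0 ≤ j - i ≤ n`. -/
structure IsFinitePattern (n : ℕ) (F : ℤ → ℤ → ℤ) : Prop where
  top_zero : ∀ i : ℤ, F i i = 0
  top_one : ∀ i : ℤ, F i (i + 1) = 1
  bottom_one : ∀ i : ℤ, F i (i + n - 1) = 1
  bottom_zero : ∀ i : ℤ, F i (i + n) = 0
  unimodular : ∀ i j : ℤ, i ≤ j → (j + 1) - (i - 1) ≤ n →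
    F (i - 1) j * F i (j + 1) - F i j * F (i - 1) (j + 1) = 1

/-- All entries of the width `n` pattern `F` off its two boundary rows of zeros are positive. -/
def IsPositive (n : ℕ) (F : ℤ → ℤ → ℤ) : Prop :=
  ∀ i j : ℤ, i < j → j < i + n → 0 < F i j

/-- `G` is an infinite frieze pattern with integer entries `G i j`, `0 ≤ j - i`. -/
structure IsInfinitePattern (G : ℤ → ℤ → ℤ) : Prop where
  top_zero : ∀ i : ℤ, G i i = 0
  top_one : ∀ i : ℤ, G i (i + 1) = 1
  unimodular : ∀ i j : ℤ, i ≤ j →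
    G (i - 1) j * G i (j + 1) - G i j * G (i - 1) (j + 1) = 1

/-- An infinite pattern is tame if each of its `3 × 3` diamonds has determinant `0`; the
condition `i + 2 ≤ j` says that the diamond lies in the pattern. -/
def IsTame (G : ℤ → ℤ → ℤ) : Prop :=
  ∀ i j : ℤ, i + 2 ≤ j →
    (Matrix.of fun a b : Fin 3 => G (i + (a.val : ℤ)) (j + (b.val : ℤ))).det = 0

/-- `G` is a tame infinite frieze pattern extending the width `n` pattern `F`. -/
structure IsTameExtension (n : ℕ) (F G : ℤ → ℤ → ℤ) : Prop where
  infinite : IsInfinitePattern G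
  tame : IsTame G
  extend : ∀ i j : ℤ, i ≤ j → j ≤ i + n → G i j = F i j

/-- `d` is the minimal (positive) period of the quiddity row `i ↦ G i (i + 2)`. -/
def IsMinimalQuiddityPeriod (G : ℤ → ℤ → ℤ) (d : ℕ) : Prop :=
  IsLeast {k : ℕ | 0 < k ∧ ∀ i : ℤ, G (i + k) (i + k + 2) = G i (i + 2)} d

/-- `s` is the principal growth coefficient of `G`: the quiddity row has a minimal period `d`,
and `G i (i + d + 1) - G (i + 1) (i + d)` equals `s` for every `i`. -/
def IsPrincipalGrowthCoefficient (G : ℤ → ℤ → ℤ) (s : ℤ) : Prop :=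
  ∃ d : ℕ, IsMinimalQuiddityPeriod G d ∧
    ∀ i : ℤ, G i (i + d + 1) - G (i + 1) (i + d) = s

/-! ### Triangulations of a polygon

The vertices of the `n`-gon are the elements of `ZMod n`, in their cyclic order. -/

/-- `e` is a side of the `n`-gon. -/
def IsSide {n : ℕ} (e : Sym2 (ZMod n)) : Prop := ∃ i : ZMod n, e = s(i, i + 1)

/-- `e` is a diagonal of the `n`-gon: it has distinct endpoints and is not a side. -/
def IsDiagonal {n : ℕ} (e : Sym2 (ZMod n)) : Prop := ¬ e.IsDiag ∧ ¬ IsSide e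

/-- Two chords cross (in the interior of the polygon): their endpoints are four distinct vertices
which alternate around the polygon. -/
def Crosses {n : ℕ} (e f : Sym2 (ZMod n)) : Prop :=
  ∃ a b c d : ZMod n, a.val < b.val ∧ b.val < c.val ∧ c.val < d.val ∧
    ((e = s(a, c) ∧ f = s(b, d)) ∨ (e = s(b, d) ∧ f = s(a, c)))

/-- A dissection: a set of pairwise non-crossing diagonals. -/
def IsDissection {n : ℕ} (T : Set (Sym2 (ZMod n))) : Prop :=
  (∀ e ∈ T, IsDiagonal e) ∧ ∀ e ∈ T, ∀ f ∈ T, ¬ Crosses e f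

/-- A triangulation: a maximal set of pairwise non-crossing diagonals. -/
def IsTriangulation {n : ℕ} (T : Set (Sym2 (ZMod n))) : Prop := Maximal IsDissection T

/-- `Δ` is the vertex set of a triangle of `T`: three vertices, any two of which are joined by a
side of the polygon or by a diagonal in `T`. (Since no vertex lies in the interior of a
triangle spanned by vertices, such a triangle is not cut by any diagonal in `T`.) -/
def IsTriangle {n : ℕ} (T : Set (Sym2 (ZMod n))) (Δ : Finset (ZMod n)) : Prop :=
  Δ.card = 3 ∧ ∀ a ∈ Δ, ∀ b ∈ Δ, a ≠ b → IsSide s(a, b) ∨ s(a, b) ∈ T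

/-- The number of triangles of `T` incident to the vertex `v`. -/
noncomputable def trianglesAt {n : ℕ} (T : Set (Sym2 (ZMod n))) (v : ZMod n) : ℕ :=
  {Δ : Finset (ZMod n) | IsTriangle T Δ ∧ v ∈ Δ}.ncard

/-- The width `n` pattern `F` is the one associated to the triangulation `T`: the entry
`F (i - 1) (i + 1)` of the quiddity row is the number of triangles at the vertex `i mod n`. -/
def IsAssociatedTo {n : ℕ} (F : ℤ → ℤ → ℤ) (T : Set (Sym2 (ZMod n))) : Prop :=
  ∀ i : ℤ, F (i - 1) (i + 1) = (trianglesAt T (i : ZMod n) : ℤ)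

/-- The image of `T` under the rotation of the polygon that adds `k` to every vertex. -/
def rotate {n : ℕ} (k : ZMod n) (T : Set (Sym2 (ZMod n))) : Set (Sym2 (ZMod n)) :=
  Sym2.map (fun v => v + k) '' T

/-- `T` has `d`-fold rotational symmetry: `d` divides `n` and `T` is invariant under the rotation
by `n / d` vertices, that is, by the angle `2π / d`. -/
def HasFoldSymmetry {n : ℕ} (d : ℕ) (T : Set (Sym2 (ZMod n))) : Prop :=
  ∃ m : ℕ, n = d * m ∧ rotate (m : ZMod n) T = T

/-- Only the trivial rotation of the polygon leaves `T` invariant. -/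
def HasNoRotationalSymmetry {n : ℕ} (T : Set (Sym2 (ZMod n))) : Prop :=
  ∀ k : ZMod n, rotate k T = T → k = 0

end Frieze

/-! Let `q v` be the number of triangles at `v` mod `n`. The extension is the Green kernel `G` of `x
(v + 1) = q v * x v - x (v - 1)`: its entries are the `2 × 2` minors of two fundamental solutions,
so the frieze rule is a Plücker relation, and tameness is the recurrence between columns.
Conversely, positivity forces the recurrence on the rows of `F`, and tameness forces it on those of
any extension; hence existence and uniqueness.

The bottom rows of `F` make `G` antiperiodic: the monodromy over `n` steps is `-1`. Let `d` be the
minimal period of `q`, let `n = d * k`, and let `t` be the trace of the monodromy over `d` steps,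
which is the growth coefficient. By Cayley-Hamilton, `g j = G 0 (j * d)` satisfies `g (j + 2) = t *
g (j + 1) - g j`; it starts at `0`, is positive for `0 < j < k`, and vanishes at `k`. Over the
integers this leaves `(k, t) = (2, 0)` or `(3, 1)` (`first_return`), besides `k = 1`, where the
monodromy is `-1` and `t = -2`.

It remains to see that rotation by `m` preserves `T` exactly when `d ∣ m`. A symmetry of `T`
preserves triangle counts. Conversely, `|G|` gives weight `1` to the diagonals of `T`
(`solution_edge`), and two chords of weight `1` cannot cross, by Ptolemy and positivity
(`not_alternate`). A period of `q` preserves weights, so it sends diagonals of `T` to diagonals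
crossing none of `T`, which lie in `T` by maximality. Thus `p`-fold symmetry means `p ∣ k`. -/

namespace Frieze

/-! ### Solutions of the discrete Hill equation -/

/-- `x` solves the second order linear recurrence with coefficients `q`. -/
def IsSolution (q x : ℤ → ℤ) : Prop := ∀ v : ℤ, x (v + 1) = q v * x v - x (v - 1)

/-- The solution on `ℕ` of the recurrence with coefficients `q` and initial values `α`, `β`. -/
def forwardSolution (q : ℕ → ℤ) (α β : ℤ) : ℕ → ℤ
  | 0 => α
  | 1 => β
  | k + 2 => q (k + 1) * forwardSolution q α β (k + 1) - forwardSolution q α β k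

theorem exists_isSolution (q : ℤ → ℤ) (α β : ℤ) :
    ∃ x : ℤ → ℤ, IsSolution q x ∧ x 0 = α ∧ x 1 = β := by
  let f := forwardSolution (fun k => q k) α β
  -- The recurrence is symmetric in time, so `g` runs it backwards; `q 0 * α - β` is the value
  -- forced at `-1`.
  let g := forwardSolution (fun k => q (-(k : ℤ))) α (q 0 * α - β)
  let x : ℤ → ℤ := fun v => if 0 ≤ v then f v.toNat else g (-v).toNat
  have hf : ∀ k : ℕ, x k = f k := fun k => by simp [x]
  have hg : ∀ k : ℕ, x (-(k : ℤ)) = g k := fun k => by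
    rcases Nat.eq_zero_or_pos k with rfl | hk
    · simp [x, f, g, forwardSolution]
    · have : ¬ (0 : ℤ) ≤ -(k : ℤ) := by omega
      simp only [x, if_neg this, neg_neg, Int.toNat_natCast]
  have h0 : x 0 = α := hf 0
  have h1 : x 1 = β := hf 1
  have hm1 : x (-1) = q 0 * α - β := hg 1
  refine ⟨x, fun v => ?_, h0, h1⟩
  obtain ⟨k, rfl | rfl⟩ := v.eq_nat_or_neg <;> rcases k with _ | k
  · simp [h0, h1, hm1]
  · have e1 := hf (k + 2)
    have e2 := hf (k + 1)
    have e3 := hf k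
    have e4 : f (k + 2) = q ((k + 1 : ℕ) : ℤ) * f (k + 1) - f k := rfl
    rw [show (((k + 1 : ℕ) : ℤ) + 1) = ((k + 2 : ℕ) : ℤ) by push_cast; ring,
      show (((k + 1 : ℕ) : ℤ) - 1) = (k : ℤ) by push_cast; ring, e1, e2, e3, e4]
  · simp [h0, h1, hm1]
  · have e1 := hg (k + 2)
    have e2 := hg (k + 1)
    have e3 := hg k
    have e4 : g (k + 2) = q (-((k + 1 : ℕ) : ℤ)) * g (k + 1) - g k := rfl
    rw [show (-((k + 1 : ℕ) : ℤ) + 1) = -(k : ℤ) by push_cast; ring,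
      show (-((k + 1 : ℕ) : ℤ) - 1) = -((k + 2 : ℕ) : ℤ) by push_cast; ring, e1, e2, e3, e4]
    ring

/-- Two solutions of the recurrence on an interval that agree at the two first places agree. -/
theorem eq_of_recurrence {q x y : ℤ → ℤ} {i m : ℤ}
    (hx : ∀ v : ℤ, i < v → v < m → x (v + 1) = q v * x v - x (v - 1))
    (hy : ∀ v : ℤ, i < v → v < m → y (v + 1) = q v * y v - y (v - 1))
    (h0 : x i = y i) (h1 : x (i + 1) = y (i + 1)) (j : ℤ) (hij : i ≤ j) (hjm : j ≤ m) :
    x j = y j := by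
  have key : ∀ k : ℕ, (i + k + 1 ≤ m ∨ k = 0) →
      x (i + k) = y (i + k) ∧ x (i + k + 1) = y (i + k + 1) := by
    intro k
    induction k with
    | zero => simpa using ⟨h0, h1⟩
    | succ k ih =>
      intro hk
      have hk' : i + (k : ℤ) + 2 ≤ m := by omega
      obtain ⟨a, b⟩ := ih (by omega)
      have e1 := hx (i + k + 1) (by omega) (by omega)
      have e2 := hy (i + k + 1) (by omega) (by omega)
      rw [show i + (k : ℤ) + 1 - 1 = i + k by ring] at e1 e2
      push_cast
      rw [← add_assoc]
      exact ⟨b, by rw [e1, e2, a, b]⟩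
  rcases hij.eq_or_lt with rfl | hlt
  · exact h0
  · have := (key (j - i - 1).toNat (by omega)).2
    rwa [show i + ((j - i - 1).toNat : ℤ) + 1 = j by omega] at this

/-- `G` is the Green kernel of the recurrence with coefficients `q`: the row `G i` is the solution
that takes the values `0`, `1` at `i`, `i + 1`. -/
structure IsKernel (q : ℤ → ℤ) (G : ℤ → ℤ → ℤ) : Prop where
  top_one : ∀ i : ℤ, G i (i + 1) = 1
  skew : ∀ i j : ℤ, G j i = -G i j
  solution : ∀ i : ℤ, IsSolution q (G i)
  ptolemy : ∀ a b c d : ℤ, G a c * G b d = G a b * G c d + G a d * G b c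

/-- Minors of a fundamental system: `ptolemy` is the Plücker relation, and `top_one` is the
constancy of the Casoratian. -/
theorem exists_isKernel (q : ℤ → ℤ) : ∃ G, IsKernel q G := by
  obtain ⟨A, hA, hA0, hA1⟩ := exists_isSolution q 1 0
  obtain ⟨B, hB, hB0, hB1⟩ := exists_isSolution q 0 1
  refine ⟨fun i j => A i * B j - A j * B i, fun i => ?_, fun i j => by ring, fun i v => ?_,
    fun a b c d => by ring⟩
  · induction i using Int.induction_on with
    | zero => simp [hA0, hA1, hB0, hB1]
    | succ i ih =>
      refine Eq.trans ?_ ih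
      rw [hA ((i : ℤ) + 1), hB ((i : ℤ) + 1), add_sub_cancel_right]
      ring
    | pred i ih =>
      refine Eq.trans ?_ ih
      rw [hA (-(i : ℤ)), hB (-(i : ℤ)), sub_add_cancel]
      ring
  · rw [hA v, hB v]
    ring

/-! ### Identities of the Green kernel and its monodromy. -/

namespace IsKernel

variable {q : ℤ → ℤ} {G : ℤ → ℤ → ℤ}

theorem self (h : IsKernel q G) (i : ℤ) : G i i = 0 := by
  have := h.skew i i
  omega

theorem left_rec (h : IsKernel q G) (i j : ℤ) : G (i + 1) j = q i * G i j - G (i - 1) j := by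
  rw [h.skew j (i + 1), h.skew j i, h.skew j (i - 1), h.solution j i]
  ring

/-- Row `i` expanded in the basis of solutions formed by rows `a` and `a + 1`. -/
theorem apply_eq (h : IsKernel q G) (i a w : ℤ) :
    G i w = G i (a + 1) * G a w - G i a * G (a + 1) w := by
  have := h.ptolemy i a (a + 1) w
  rw [h.top_one] at this
  linarith

theorem quiddity (h : IsKernel q G) (i : ℤ) : G (i - 1) (i + 1) = q i := by
  have e := h.top_one (i - 1)
  rw [sub_add_cancel] at e
  rw [h.solution (i - 1) i, h.self, e]
  ring

theorem isInfinitePattern (h : IsKernel q G) : IsInfinitePattern G where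
  top_zero := h.self
  top_one := h.top_one
  unimodular i j _ := by
    have e := h.ptolemy (i - 1) i j (j + 1)
    have e' := h.top_one (i - 1)
    rw [sub_add_cancel] at e'
    rw [h.top_one j, e'] at e
    linarith

theorem isTame (h : IsKernel q G) : IsTame G := by
  intro i j _
  have e : ∀ k, G k (j + 2) = q (j + 1) * G k (j + 1) - G k j := fun k => by
    have := h.solution k (j + 1)
    rwa [add_sub_cancel_right, add_assoc] at this
  rw [Matrix.det_fin_three]
  simp [e]
  ring

theorem translate (h : IsKernel q G) {d : ℤ} (hq : ∀ v, q (v + d) = q v) (i j : ℤ) :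
    G (i + d) (j + d) = G i j := by
  have key : ∀ i j : ℤ, i ≤ j → G (i + d) (j + d) = G i j := fun i j hij =>
    eq_of_recurrence (q := q) (x := fun v => G (i + d) (v + d)) (y := G i) (i := i) (m := j)
      (fun v _ _ => by
        have := h.solution (i + d) (v + d)
        rwa [hq, show v + d + 1 = v + 1 + d by ring, show v + d - 1 = v - 1 + d by ring] at this)
      (fun v _ _ => h.solution i v)
      (by simp [h.self])
      (by simp only [h.top_one, show i + 1 + d = i + d + 1 by ring]) j hij le_rfl
  rcases le_total i j with hij | hij
  · exact key i j hij
  · rw [h.skew (j + d), h.skew j, key j i hij]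

/-- The trace of the monodromy does not depend on the base point. -/
theorem trace_const (h : IsKernel q G) {d : ℤ} (hq : ∀ v, q (v + d) = q v) (i : ℤ) :
    G i (i + d + 1) - G (i + 1) (i + d) = G 0 (0 + d + 1) - G (0 + 1) (0 + d) := by
  have step : ∀ i : ℤ, G (i + 1) (i + 1 + d + 1) - G (i + 1 + 1) (i + 1 + d) =
      G i (i + d + 1) - G (i + 1) (i + d) := fun i => by
    have e1 := h.solution (i + 1) (i + 1 + d)
    have e2 := h.left_rec (i + 1) (i + 1 + d)
    rw [hq] at e1
    rw [show i + 1 + d - 1 = i + d by ring] at e1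
    rw [add_sub_cancel_right] at e2
    rw [e1, e2, show i + 1 + d = i + d + 1 by ring]
    ring
  induction i using Int.induction_on with
  | zero => rfl
  | succ i ih => rw [step, ih]
  | pred i ih =>
    rw [← step, sub_add_cancel, ih]

/-- The Cayley-Hamilton relation for the monodromy. -/
theorem cayley_hamilton (h : IsKernel q G) {d : ℤ} (hq : ∀ v, q (v + d) = q v) (i v : ℤ) :
    G i (v + d + d) = (G 0 (0 + d + 1) - G (0 + 1) (0 + d)) * G i (v + d) - G i v := by
  have e1 := h.apply_eq i (v + d) (v + d + d)
  have e2 := h.apply_eq i (v + d) v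
  have t1 := h.translate hq v (v + d)
  have t2 := h.translate hq (v + 1) (v + d)
  rw [show v + 1 + d = v + d + 1 by ring] at t2
  rw [t1, t2] at e1
  rw [h.skew v (v + d), h.skew v (v + d + 1)] at e2
  rw [← h.trace_const hq v, e1, e2]
  ring

theorem antiperiodic_right (h : IsKernel q G) {n : ℤ} (h0 : ∀ i, G i (i + n) = 0)
    (h1 : ∀ i, G i (i + n - 1) = 1) (i j : ℤ) : G i (j + n) = -G i j := by
  have e := h.apply_eq i j (j + n)
  have e1 := h1 (j + 1)
  rw [show j + 1 + n - 1 = j + n by ring] at e1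
  rw [e, h0, e1]
  ring

theorem abs_add_mul (h : IsKernel q G) {n : ℤ} (h0 : ∀ i, G i (i + n) = 0)
    (h1 : ∀ i, G i (i + n - 1) = 1) (i j k : ℤ) : |G i (j + n * k)| = |G i j| := by
  induction k using Int.induction_on with
  | zero => simp
  | succ k ih =>
    rw [mul_add, mul_one, ← add_assoc, h.antiperiodic_right h0 h1, abs_neg, ih]
  | pred k ih =>
    rw [← ih, ← abs_neg (G i (j + n * (-(k : ℤ) - 1))), ← h.antiperiodic_right h0 h1]
    congr 2
    ring

/-- By antiperiodicity in both variables, `|G|` descends to a weight on the chords of the `n`-gon.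
-/
theorem abs_congr (h : IsKernel q G) {n : ℤ} (h0 : ∀ i, G i (i + n) = 0)
    (h1 : ∀ i, G i (i + n - 1) = 1) {i i' j j' : ℤ} (hi : n ∣ i' - i) (hj : n ∣ j' - j) :
    |G i' j'| = |G i j| := by
  obtain ⟨k, hk⟩ := hi
  obtain ⟨l, hl⟩ := hj
  obtain rfl : i' = i + n * k := by linarith
  obtain rfl : j' = j + n * l := by linarith
  rw [h.abs_add_mul h0 h1, h.skew j, abs_neg, h.abs_add_mul h0 h1, h.skew i j, abs_neg]

end IsKernel

/-! ### Recurrences in frieze patterns -/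

/-- The rows of a positive frieze pattern satisfy the recurrence given by its quiddity row. -/
theorem IsFinitePattern.recurrence {n : ℕ} {F : ℤ → ℤ → ℤ} (hF : IsFinitePattern n F)
    (hpos : IsPositive n F) (i v : ℤ) (hiv : i < v) (hvn : v < i + n) :
    F i (v + 1) = F (v - 1) (v + 1) * F i v - F i (v - 1) := by
  have key : ∀ k : ℕ, v < v - 1 - k + n → F (v - 1 - k) (v + 1) =
      F (v - 1) (v + 1) * F (v - 1 - k) v - F (v - 1 - k) (v - 1) := by
    intro k
    induction k with
    | zero =>
      have e := hF.top_one (v - 1)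
      rw [sub_add_cancel] at e
      simp [e, hF.top_zero]
    | succ k ih =>
      intro hk
      push_cast at hk ⊢
      set i := v - 1 - (k : ℤ) with hi
      rw [show v - 1 - ((k : ℤ) + 1) = i - 1 by ring]
      have e := ih (by omega)
      have u1 := hF.unimodular i v (by omega) (by omega)
      have u2 := hF.unimodular i (v - 1) (by omega) (by omega)
      rw [sub_add_cancel] at u2
      have hp := hpos i v (by omega) (by omega)
      -- The two adjacent diamonds determine the new entry only after multiplication by `F i v`;
      -- positivity allows the cancellation.
      apply mul_left_cancel₀ hp.ne'
      rw [e] at u1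
      linear_combination u2 - u1
  have := key (v - 1 - i).toNat (by omega)
  rwa [show v - 1 - ((v - 1 - i).toNat : ℤ) = i by omega] at this

/-- The rows of a tame infinite frieze pattern satisfy the recurrence given by its quiddity
row. -/
theorem IsInfinitePattern.recurrence {G : ℤ → ℤ → ℤ} (hG : IsInfinitePattern G)
    (ht : IsTame G) (i v : ℤ) (hiv : i < v) :
    G i (v + 1) = G (v - 1) (v + 1) * G i v - G i (v - 1) := by
  -- Two consecutive rows are carried along, because a `3 × 3` diamond passes the relation from two
  -- rows to the third.
  have key : ∀ k : ℕ,
      (G (v - 1 - k) (v + 1) =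
        G (v - 1) (v + 1) * G (v - 1 - k) v - G (v - 1 - k) (v - 1)) ∧
      (G (v - 1 - k - 1) (v + 1) =
        G (v - 1) (v + 1) * G (v - 1 - k - 1) v - G (v - 1 - k - 1) (v - 1)) := by
    intro k
    induction k with
    | zero =>
      have e := hG.top_one (v - 1)
      have e' := hG.top_one (v - 1 - 1)
      have u := hG.unimodular (v - 1) v (by omega)
      rw [sub_add_cancel] at e e'
      rw [e] at u
      simp only [Nat.cast_zero, sub_zero]
      refine ⟨by simp [e, hG.top_zero], ?_⟩
      rw [e']
      linarith
    | succ k ih =>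
      push_cast
      obtain ⟨a, b⟩ := ih
      rw [show v - 1 - ((k : ℤ) + 1) = v - 1 - k - 1 by ring]
      refine ⟨b, ?_⟩
      have t := ht (v - 1 - k - 1 - 1) (v - 1) (by omega)
      have u := hG.unimodular (v - 1 - k) (v - 1) (by omega)
      rw [Matrix.det_fin_three] at t
      simp only [Matrix.of_apply, Fin.val_zero, Fin.val_one, Fin.val_two, Nat.cast_zero,
        Nat.cast_one, Nat.cast_ofNat, add_zero, sub_add_cancel] at t
      rw [show v - 1 - (k : ℤ) - 1 - 1 + 2 = v - 1 - k by ring,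
        show v - 1 + 2 = v + 1 by ring] at t
      rw [sub_add_cancel] at u
      rw [a, b] at t
      -- Subtracting the relation from the last column leaves only the defect of the top row there,
      -- and its cofactor is `1` by unimodularity.
      linear_combination t - (G (v - 1 - k - 1 - 1) (v + 1) -
        G (v - 1) (v + 1) * G (v - 1 - k - 1 - 1) v + G (v - 1 - k - 1 - 1) (v - 1)) * u
  have := (key (v - 1 - i).toNat).1
  rwa [show v - 1 - ((v - 1 - i).toNat : ℤ) = i by omega] at this

theorem IsKernel.extend {n : ℕ} {F G : ℤ → ℤ → ℤ} {q : ℤ → ℤ} (h : IsKernel q G)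
    (hF : IsFinitePattern n F) (hpos : IsPositive n F) (hq : ∀ v, F (v - 1) (v + 1) = q v)
    (i j : ℤ) (hij : i ≤ j) (hj : j ≤ i + n) : G i j = F i j :=
  eq_of_recurrence (q := q) (m := i + n) (fun v _ _ => h.solution i v)
    (fun v h1 h2 => by rw [hF.recurrence hpos i v h1 h2, hq])
    (by rw [h.self, hF.top_zero]) (by rw [h.top_one, hF.top_one]) j hij hj

theorem IsKernel.unique {G G' : ℤ → ℤ → ℤ} {q : ℤ → ℤ} (h : IsKernel q G)
    (hG : IsInfinitePattern G') (ht : IsTame G') (hq : ∀ v, G' (v - 1) (v + 1) = q v)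
    (i j : ℤ) (hij : i ≤ j) : G' i j = G i j :=
  eq_of_recurrence (q := q) (m := j)
    (fun v h1 _ => by rw [hG.recurrence ht i v h1, hq]) (fun v _ _ => h.solution i v)
    (by rw [h.self, hG.top_zero]) (by rw [h.top_one, hG.top_one]) j hij le_rfl

/-- A sequence `0, g 1, …` with `g (j + 2) = t * g (j + 1) - g j` that is positive until its first
return to `0` at the place `k` has `(k, t) = (2, 0)` or `(3, 1)`, unless `k = 1`. -/
theorem first_return {g : ℕ → ℤ} {t : ℤ} {k : ℕ} (hk : 2 ≤ k) (h0 : g 0 = 0)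
    (hrec : ∀ j, g (j + 2) = t * g (j + 1) - g j) (hkz : g k = 0)
    (hpos : ∀ j, 0 < j → j < k → 0 < g j) : (k = 2 ∧ t = 0) ∨ (k = 3 ∧ t = 1) := by
  have g1 := hpos 1 (by omega) (by omega)
  have e2 := hrec 0
  have e3 := hrec 1
  simp only [zero_add, h0, sub_zero, Nat.reduceAdd] at e2 e3
  rcases Nat.lt_or_ge 2 k with hk2 | hk2
  · right
    have ht : 0 < t := by
      have := hpos 2 (by omega) hk2
      rw [e2] at this
      exact pos_of_mul_pos_left this g1.le
    rcases Nat.lt_or_ge 3 k with hk3 | hk3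
    · exfalso
      have h2 : 2 ≤ t := by
        have := hpos 3 (by omega) hk3
        rw [e3, e2] at this
        by_contra hlt
        obtain rfl : t = 1 := by omega
        linarith
      -- For `2 ≤ t` the increments never decrease, so the sequence grows strictly and cannot return
      -- to `0`.
      have inc : ∀ j, 0 ≤ g j ∧ g j < g (j + 1) := by
        intro j
        induction j with
        | zero => simpa [h0] using g1
        | succ j ih => exact ⟨by omega, by rw [hrec]; nlinarith⟩
      have := inc (k - 1)
      rw [Nat.sub_add_cancel (by omega)] at this
      omega
    · obtain rfl : k = 3 := by omega
      refine ⟨rfl, ?_⟩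
      rw [e3, e2] at hkz
      have : (t - 1) * ((t + 1) * g 1) = 0 := by linear_combination hkz
      rcases mul_eq_zero.mp this with h | h
      · omega
      · have : 0 < (t + 1) * g 1 := by positivity
        omega
  · left
    obtain rfl : k = 2 := by omega
    refine ⟨rfl, ?_⟩
    rw [e2] at hkz
    exact (mul_eq_zero.mp hkz).resolve_right g1.ne'

/-! ### Triangulations -/

section Triangulation

variable {n : ℕ} {T : Set (Sym2 (ZMod n))}

/-- `u` and `v` are joined by a side of the polygon or by a diagonal in `T`. -/
def IsEdge (T : Set (Sym2 (ZMod n))) (u v : ZMod n) : Prop := IsSide s(u, v) ∨ s(u, v) ∈ T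

theorem IsEdge.symm {u v : ZMod n} (h : IsEdge T u v) : IsEdge T v u := by
  unfold IsEdge
  rwa [Sym2.eq_swap]

theorem IsTriangle.isEdge {Δ : Finset (ZMod n)} (h : IsTriangle T Δ) {u v : ZMod n}
    (hu : u ∈ Δ) (hv : v ∈ Δ) (huv : u.val ≠ v.val) : IsEdge T u v :=
  h.2 u hu v hv fun e => huv (e ▸ rfl)

theorem val_add_one_eq [NeZero n] (i : ZMod n) :
    (i + 1).val = i.val + 1 ∨ (i.val + 1 = n ∧ (i + 1).val = 0) := by
  have hi := i.val_lt
  have e : (i + 1).val = (i.val + 1) % n := by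
    rw [ZMod.val_add, ZMod.val_one_eq_one_mod, Nat.add_mod_mod]
  rcases Nat.lt_or_ge (i.val + 1) n with h | h
  · left
    rw [e, Nat.mod_eq_of_lt h]
  · right
    obtain h' : i.val + 1 = n := by omega
    exact ⟨h', by rw [e, h', Nat.mod_self]⟩

theorem add_one_eq_of_val [NeZero n] {a b : ZMod n} (h : b.val = a.val + 1) : b = a + 1 := by
  apply ZMod.val_injective n
  have := b.val_lt
  rcases val_add_one_eq a with e | ⟨e, -⟩ <;> omega

theorem isEdge_of_val [NeZero n] {a b : ZMod n} (h : b.val = a.val + 1) : IsEdge T a b :=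
  Or.inl ⟨a, by rw [add_one_eq_of_val h]⟩

/-- The only side with a vertex between its endpoints is the one joining `0` and `n - 1`. -/
theorem IsSide.val_eq [NeZero n] {a b x : ZMod n} (h : IsSide s(a, b)) (hax : a.val < x.val)
    (hxb : x.val < b.val) : a.val = 0 ∧ b.val + 1 = n := by
  obtain ⟨i, hi⟩ := h
  have := val_add_one_eq i
  rcases Sym2.eq_iff.mp hi with ⟨rfl, rfl⟩ | ⟨rfl, rfl⟩ <;> omega

/-- Sides are harmless: one separating two vertices would have to join `0` and `n - 1`, leaving no
room for the fourth vertex. -/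
theorem IsDissection.not_isEdge [NeZero n] (hT : IsDissection T) {a b c d : ZMod n}
    (hab : a.val < b.val) (hbc : b.val < c.val) (hcd : c.val < d.val) (hac : IsEdge T a c) :
    ¬ IsEdge T b d := by
  rintro (hbd | hbd)
  · have := hbd.val_eq hbc hcd
    omega
  · rcases hac with hac | hac
    · have := hac.val_eq hab hbc
      have := d.val_lt
      omega
    · exact hT.2 _ hac _ hbd ⟨a, b, c, d, hab, hbc, hcd, Or.inl ⟨rfl, rfl⟩⟩

theorem Crosses.symm {e f : Sym2 (ZMod n)} (h : Crosses e f) : Crosses f e := by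
  obtain ⟨a, b, c, d, h1, h2, h3, h⟩ := h
  exact ⟨a, b, c, d, h1, h2, h3, h.symm.imp And.symm And.symm⟩

theorem not_crosses_self (e : Sym2 (ZMod n)) : ¬ Crosses e e := by
  rintro ⟨a, b, c, d, h1, h2, h3, ⟨h, h'⟩ | ⟨h, h'⟩⟩ <;>
  · rw [h] at h'
    rcases Sym2.eq_iff.mp h' with ⟨rfl, rfl⟩ | ⟨rfl, rfl⟩ <;> omega

theorem IsTriangulation.mem_of_not_crosses (hT : IsTriangulation T) {e : Sym2 (ZMod n)}
    (he : IsDiagonal e) (h : ∀ f ∈ T, ¬ Crosses e f) : e ∈ T := by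
  have hd : IsDissection (insert e T) := by
    refine ⟨?_, ?_⟩
    · rintro f (rfl | hf)
      exacts [he, hT.prop.1 f hf]
    · rintro f (rfl | hf) g (rfl | hg)
      · exact not_crosses_self _
      · exact h g hg
      · exact fun hc => h f hf hc.symm
      · exact hT.prop.2 f hf g hg
  exact hT.le_of_ge hd (Set.subset_insert e T) (Set.mem_insert e T)

/-- If `c < b` and the chord `s(c, b)` crosses `f`, then `f` has one endpoint strictly between `c`
and `b` and the other outside. -/
theorem Crosses.exists_of_lt {c b : ZMod n} {f : Sym2 (ZMod n)} (hcb : c.val < b.val)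
    (h : Crosses s(c, b) f) :
    (∃ y w : ZMod n, f = s(y, w) ∧ c.val < y.val ∧ y.val < b.val ∧ b.val < w.val) ∨
    ∃ x z : ZMod n, f = s(x, z) ∧ x.val < c.val ∧ c.val < z.val ∧ z.val < b.val := by
  obtain ⟨x, y, z, w, h1, h2, h3, ⟨h, rfl⟩ | ⟨h, rfl⟩⟩ := h
  · left
    rcases Sym2.eq_iff.mp h with ⟨rfl, rfl⟩ | ⟨rfl, rfl⟩
    · exact ⟨y, w, rfl, h1, h2, h3⟩
    · omega
  · right
    rcases Sym2.eq_iff.mp h with ⟨rfl, rfl⟩ | ⟨rfl, rfl⟩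
    · exact ⟨x, z, rfl, h1, h2, h3⟩
    · omega

/-- Below every edge of a triangulation there is a triangle. -/
theorem IsTriangulation.exists_apex [NeZero n] (hT : IsTriangulation T) {a b : ZMod n}
    (hab : a.val + 1 < b.val) (he : IsEdge T a b) :
    ∃ c : ZMod n, a.val < c.val ∧ c.val < b.val ∧ IsEdge T a c ∧ IsEdge T c b := by
  have hne : {c : ZMod n | a.val < c.val ∧ c.val < b.val ∧ IsEdge T a c}.Nonempty := by
    have hv : (a + 1).val = a.val + 1 := by
      have := b.val_lt
      rcases val_add_one_eq a with e | ⟨e, -⟩ <;> omega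
    exact ⟨a + 1, by omega, by omega, isEdge_of_val hv⟩
  -- The apex is the farthest neighbour of `a` before `b`. A diagonal crossing `s(c, b)` but neither
  -- `s(a, b)` nor `s(a, c)` would join `a` to a vertex beyond `c`.
  obtain ⟨c, ⟨hac, hcb, hec⟩, hmax⟩ := Set.exists_max_image _ ZMod.val (Set.toFinite _) hne
  refine ⟨c, hac, hcb, hec, ?_⟩
  by_contra hn
  unfold IsEdge at hn
  push Not at hn
  refine hn.2 (hT.mem_of_not_crosses ⟨?_, hn.1⟩ fun f hf hcr => ?_)
  · rw [Sym2.mk_isDiag_iff]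
    rintro rfl
    omega
  · rcases hcr.exists_of_lt hcb with ⟨y, w, rfl, h1, h2, h3⟩ | ⟨x, z, rfl, h1, h2, h3⟩
    · exact hT.prop.not_isEdge (by omega) h2 h3 he (Or.inr hf)
    · rcases lt_trichotomy x.val a.val with h | h | h
      · exact hT.prop.not_isEdge h (by omega) h3 (Or.inr hf) he
      · obtain rfl := ZMod.val_injective n h
        have := hmax z ⟨by omega, h3, Or.inr hf⟩
        omega
      · exact hT.prop.not_isEdge h h1 h2 hec (Or.inr hf)

/-- The triangles of `T` at the vertex `v` with all vertices between `a` and `b`. -/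
def trianglesBetween (T : Set (Sym2 (ZMod n))) (a b v : ZMod n) : Set (Finset (ZMod n)) :=
  {Δ | IsTriangle T Δ ∧ v ∈ Δ ∧ ∀ u ∈ Δ, a.val ≤ u.val ∧ u.val ≤ b.val}

theorem trianglesBetween_eq_empty [NeZero n] {a b : ZMod n} (hab : b.val ≤ a.val + 1)
    (v : ZMod n) : trianglesBetween T a b v = ∅ := by
  rw [Set.eq_empty_iff_forall_notMem]
  rintro Δ ⟨hΔ, -, h⟩
  have hsub : Δ ⊆ {a, b} := fun u hu => by
    have := h u hu
    rw [Finset.mem_insert, Finset.mem_singleton]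
    rcases Nat.lt_or_ge a.val u.val with h' | h'
    · exact Or.inr (ZMod.val_injective n (by omega))
    · exact Or.inl (ZMod.val_injective n (by omega))
  have := (Finset.card_le_card hsub).trans Finset.card_le_two
  have := hΔ.1
  omega

theorem card_apex_triangle {a b c : ZMod n} (hac : a.val < c.val) (hcb : c.val < b.val) :
    ({a, c, b} : Finset (ZMod n)).card = 3 := by
  rw [Finset.card_eq_three]
  refine ⟨a, c, b, ?_, ?_, ?_, rfl⟩ <;>
  · rintro rfl
    omega

theorem IsTriangle.eq_apex_triangle [NeZero n] {a b c : ZMod n} (hac : a.val < c.val)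
    (hcb : c.val < b.val) {Δ : Finset (ZMod n)} (hΔ : IsTriangle T Δ)
    (h : ∀ u ∈ Δ, u.val = a.val ∨ u.val = c.val ∨ u.val = b.val) : Δ = {a, c, b} := by
  apply Finset.eq_of_subset_of_card_le
  · intro u hu
    rw [Finset.mem_insert, Finset.mem_insert, Finset.mem_singleton]
    exact (h u hu).imp (fun e => ZMod.val_injective n e)
      (Or.imp (fun e => ZMod.val_injective n e) fun e => ZMod.val_injective n e)
  · rw [card_apex_triangle hac hcb, hΔ.1]

theorem isTriangle_apex {a b c : ZMod n} (hac : a.val < c.val) (hcb : c.val < b.val)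
    (eab : IsEdge T a b) (eac : IsEdge T a c) (ecb : IsEdge T c b) :
    IsTriangle T {a, c, b} := by
  refine ⟨card_apex_triangle hac hcb, ?_⟩
  intro u hu v hv huv
  change IsEdge T u v
  simp only [Finset.mem_insert, Finset.mem_singleton] at hu hv
  rcases hu with rfl | rfl | rfl <;> rcases hv with rfl | rfl | rfl <;>
    first
    | exact absurd rfl huv
    | assumption
    | (apply IsEdge.symm; assumption)

theorem mem_trianglesBetween_apex {a b c v : ZMod n} (hac : a.val < c.val)
    (hcb : c.val < b.val) (eab : IsEdge T a b) (eac : IsEdge T a c) (ecb : IsEdge T c b)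
    (hv : v ∈ ({a, c, b} : Finset (ZMod n))) :
    {a, c, b} ∈ trianglesBetween T a b v := by
  refine ⟨isTriangle_apex hac hcb eab eac ecb, hv, fun u hu => ?_⟩
  simp only [Finset.mem_insert, Finset.mem_singleton] at hu
  rcases hu with rfl | rfl | rfl <;> omega

/-- A triangle at `a` below `s(a, b)` that reaches beyond `c` must be the apex triangle, since its
edges cross neither `s(a, c)` nor `s(c, b)`. -/
theorem ncard_trianglesBetween_left [NeZero n] {a b c : ZMod n} (hT : IsDissection T)
    (hac : a.val < c.val) (hcb : c.val < b.val) (eab : IsEdge T a b)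
    (eac : IsEdge T a c) (ecb : IsEdge T c b) :
    (trianglesBetween T a b a).ncard = (trianglesBetween T a c a).ncard + 1 := by
  have e : trianglesBetween T a b a = insert {a, c, b} (trianglesBetween T a c a) := by
    ext Δ
    rw [Set.mem_insert_iff]
    constructor
    · rintro ⟨hΔ, ha, h⟩
      by_cases hc : ∀ u ∈ Δ, u.val ≤ c.val
      · exact Or.inr ⟨hΔ, ha, fun u hu => ⟨(h u hu).1, hc u hu⟩⟩
      · left
        push Not at hc
        obtain ⟨y, hy, hcy⟩ := hc
        have hyb := h y hy
        obtain rfl : y = b := by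
          by_contra hne
          have : y.val ≠ b.val := fun e => hne (ZMod.val_injective n e)
          exact hT.not_isEdge hac hcy (by omega) (hΔ.isEdge ha hy (by omega)) ecb
        refine hΔ.eq_apex_triangle hac hcb fun x hx => ?_
        have hxb := h x hx
        by_contra! hne
        rcases Nat.lt_or_ge x.val c.val with hxc | hxc
        · exact hT.not_isEdge (by omega) hxc hcb eac (hΔ.isEdge hx hy (by omega))
        · exact hT.not_isEdge hac (by omega) (by omega) (hΔ.isEdge ha hx (by omega)) ecb
    · rintro (rfl | ⟨hΔ, ha, h⟩)
      · exact mem_trianglesBetween_apex hac hcb eab eac ecb (by simp)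
      · exact ⟨hΔ, ha, fun u hu => ⟨(h u hu).1, (h u hu).2.trans hcb.le⟩⟩
  rw [e, Set.ncard_insert_of_notMem]
  rintro ⟨-, -, h⟩
  have := h b (by simp)
  omega

theorem ncard_trianglesBetween_right [NeZero n] {a b c : ZMod n} (hT : IsDissection T)
    (hac : a.val < c.val) (hcb : c.val < b.val) (eab : IsEdge T a b)
    (eac : IsEdge T a c) (ecb : IsEdge T c b) :
    (trianglesBetween T a b b).ncard = (trianglesBetween T c b b).ncard + 1 := by
  have e : trianglesBetween T a b b = insert {a, c, b} (trianglesBetween T c b b) := by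
    ext Δ
    rw [Set.mem_insert_iff]
    constructor
    · rintro ⟨hΔ, hb, h⟩
      by_cases hc : ∀ u ∈ Δ, c.val ≤ u.val
      · exact Or.inr ⟨hΔ, hb, fun u hu => ⟨hc u hu, (h u hu).2⟩⟩
      · left
        push Not at hc
        obtain ⟨y, hy, hcy⟩ := hc
        have hya := h y hy
        obtain rfl : y = a := by
          by_contra hne
          have : y.val ≠ a.val := fun e => hne (ZMod.val_injective n e)
          exact hT.not_isEdge (by omega) hcy hcb eac (hΔ.isEdge hy hb (by omega))
        refine hΔ.eq_apex_triangle hac hcb fun x hx => ?_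
        have hxa := h x hx
        by_contra! hne
        rcases Nat.lt_or_ge x.val c.val with hxc | hxc
        · exact hT.not_isEdge (by omega) hxc hcb eac (hΔ.isEdge hx hb (by omega))
        · exact hT.not_isEdge hac (by omega) (by omega) (hΔ.isEdge hy hx (by omega)) ecb
    · rintro (rfl | ⟨hΔ, hb, h⟩)
      · exact mem_trianglesBetween_apex hac hcb eab eac ecb (by simp)
      · exact ⟨hΔ, hb, fun u hu => ⟨hac.le.trans (h u hu).1, (h u hu).2⟩⟩
  rw [e, Set.ncard_insert_of_notMem]
  rintro ⟨-, -, h⟩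
  have := h a (by simp)
  omega

/-- No triangle at `c` leaves the range from `a` to `b`, as it would cross `s(a, b)`; one with
vertices strictly on both sides of `c` is the apex triangle. -/
theorem trianglesAt_apex [NeZero n] {a b c : ZMod n} (hT : IsDissection T)
    (hac : a.val < c.val) (hcb : c.val < b.val) (eab : IsEdge T a b)
    (eac : IsEdge T a c) (ecb : IsEdge T c b) :
    trianglesAt T c =
      (trianglesBetween T a c c).ncard + (trianglesBetween T c b c).ncard + 1 := by
  have e : {Δ : Finset (ZMod n) | IsTriangle T Δ ∧ c ∈ Δ} =
      insert {a, c, b} (trianglesBetween T a c c ∪ trianglesBetween T c b c) := by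
    ext Δ
    rw [Set.mem_insert_iff, Set.mem_union]
    constructor
    · rintro ⟨hΔ, hc⟩
      have h : ∀ u ∈ Δ, a.val ≤ u.val ∧ u.val ≤ b.val := by
        intro u hu
        by_contra hn
        rcases Nat.lt_or_ge u.val a.val with hua | hua
        · exact hT.not_isEdge hua hac hcb (hΔ.isEdge hu hc (by omega)) eab
        · exact hT.not_isEdge hac hcb (by omega) eab (hΔ.isEdge hc hu (by omega))
      by_cases h1 : ∀ u ∈ Δ, u.val ≤ c.val
      · exact Or.inr (Or.inl ⟨hΔ, hc, fun u hu => ⟨(h u hu).1, h1 u hu⟩⟩)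
      by_cases h2 : ∀ u ∈ Δ, c.val ≤ u.val
      · exact Or.inr (Or.inr ⟨hΔ, hc, fun u hu => ⟨h2 u hu, (h u hu).2⟩⟩)
      left
      push Not at h1 h2
      obtain ⟨y, hy, hcy⟩ := h1
      obtain ⟨x, hx, hxc⟩ := h2
      have key : ∀ x ∈ Δ, ∀ y ∈ Δ, x.val < c.val → c.val < y.val →
          x.val = a.val ∧ y.val = b.val := by
        intro x hx y hy hxc hcy
        have exy := hΔ.isEdge hx hy (by omega)
        have hxa := h x hx
        have hyb := h y hy
        constructor
        · by_contra hne
          exact hT.not_isEdge (by omega) hxc hcy eac exy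
        · by_contra hne
          exact hT.not_isEdge hxc hcy (by omega) exy ecb
      refine hΔ.eq_apex_triangle hac hcb fun z hz => ?_
      rcases lt_trichotomy z.val c.val with hzc | hzc | hzc
      · exact Or.inl (key z hz y hy hzc hcy).1
      · exact Or.inr (Or.inl hzc)
      · exact Or.inr (Or.inr (key x hx z hz hxc hzc).2)
    · rintro (rfl | ⟨hΔ, hc, -⟩ | ⟨hΔ, hc, -⟩)
      · exact ⟨isTriangle_apex hac hcb eab eac ecb, by simp⟩
      · exact ⟨hΔ, hc⟩
      · exact ⟨hΔ, hc⟩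
  rw [trianglesAt, e, Set.ncard_insert_of_notMem, Set.ncard_union_eq]
  · rw [Set.disjoint_left]
    rintro Δ ⟨hΔ, hc, h1⟩ ⟨-, -, h2⟩
    have hmem : Δ ∈ trianglesBetween T c c c :=
      ⟨hΔ, hc, fun u hu => ⟨(h2 u hu).1, (h1 u hu).2⟩⟩
    rw [trianglesBetween_eq_empty (by omega)] at hmem
    exact hmem
  · rintro (⟨-, -, h⟩ | ⟨-, -, h⟩)
    · have := h b (by simp)
      omega
    · have := h a (by simp)
      omega

/-- The values at the neighbours of an edge of a solution of the recurrence given by the triangle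
numbers of a triangulation. -/
theorem IsTriangulation.solution_edge [NeZero n] (hT : IsTriangulation T) {x : ℤ → ℤ}
    (hx : IsSolution (fun v : ℤ => (trianglesAt T (v : ZMod n) : ℤ)) x) (m : ℕ) :
    ∀ a b : ZMod n, b.val = a.val + m + 1 → IsEdge T a b →
      x (a.val + 1) = (trianglesBetween T a b a).ncard * x a.val + x b.val ∧
      x (b.val - 1) = (trianglesBetween T a b b).ncard * x b.val + x a.val := by
  induction m using Nat.strong_induction_on with
  | _ m ih =>
    intro a b hab eab
    rcases Nat.eq_zero_or_pos m with rfl | hm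
    · have hab' : (b.val : ℤ) = a.val + 1 := by exact_mod_cast hab
      rw [trianglesBetween_eq_empty (by omega), trianglesBetween_eq_empty (by omega), hab']
      simp
    · obtain ⟨c, hac, hcb, eac, ecb⟩ := hT.exists_apex (by omega) eab
      obtain ⟨l1, l2⟩ := ih (c.val - a.val - 1) (by omega) a c (by omega) eac
      obtain ⟨r1, r2⟩ := ih (b.val - c.val - 1) (by omega) c b (by omega) ecb
      have hc := hx c.val
      simp only [Int.cast_natCast, ZMod.natCast_zmod_val] at hc
      rw [trianglesAt_apex hT.prop hac hcb eab eac ecb] at hc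
      rw [ncard_trianglesBetween_left hT.prop hac hcb eab eac ecb,
        ncard_trianglesBetween_right hT.prop hac hcb eab eac ecb]
      push_cast at hc ⊢
      -- The two inductive formulas at `c` turn the recurrence there into additivity at the apex.
      have key : x c.val = x a.val + x b.val := by linear_combination l2 + r1 - hc
      constructor
      · rw [l1, key]
        ring
      · rw [r2, key]
        ring

/-- Apply `solution_edge` to the solution with values `0`, `1` at `a`, `a + 1`. -/
theorem IsTriangulation.kernel_edge [NeZero n] (hT : IsTriangulation T) {G : ℤ → ℤ → ℤ}
    (hG : IsKernel (fun v : ℤ => (trianglesAt T (v : ZMod n) : ℤ)) G) {a b : ZMod n}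
    (hab : a.val < b.val) (e : IsEdge T a b) : G a.val b.val = 1 := by
  have := (hT.solution_edge (hG.solution a.val) (b.val - a.val - 1) a b (by omega) e).1
  rw [hG.self, hG.top_one] at this
  linarith

end Triangulation

/-! ### Rotational symmetry and periodicity -/

section Rotation

variable {n : ℕ} {T : Set (Sym2 (ZMod n))}

/-- Rotation injects the triangles at `v` into those at `v + k`; applying this to `-k` as well gives
equality. -/
theorem trianglesAt_le_of_rotate_eq [NeZero n] {k : ZMod n} (h : rotate k T = T) (v : ZMod n) :
    trianglesAt T v ≤ trianglesAt T (v + k) := by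
  have hinj : Function.Injective fun u : ZMod n => u + k := add_left_injective k
  refine Set.ncard_le_ncard_of_injOn (fun Δ => Δ.image fun u => u + k) ?_
    (Finset.image_injective hinj).injOn
  rintro Δ ⟨⟨hc, he⟩, hv⟩
  refine ⟨⟨by rw [Finset.card_image_of_injective _ hinj, hc], ?_⟩,
    Finset.mem_image_of_mem _ hv⟩
  intro a ha b hb hab
  obtain ⟨a, ha', rfl⟩ := Finset.mem_image.mp ha
  obtain ⟨b, hb', rfl⟩ := Finset.mem_image.mp hb
  rcases he a ha' b hb' (fun e => hab (by rw [e])) with ⟨i, hi⟩ | hT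
  · left
    refine ⟨i + k, ?_⟩
    have := congrArg (Sym2.map fun u : ZMod n => u + k) hi
    simpa only [Sym2.map_mk, add_right_comm] using this
  · right
    rw [← h]
    exact ⟨s(a, b), hT, rfl⟩

theorem rotate_neg_eq {k : ZMod n} (h : rotate k T = T) : rotate (-k) T = T := by
  conv_lhs => rw [← h]
  unfold rotate
  rw [← Set.image_comp, ← Sym2.map_comp]
  have e : ((fun v => v + -k) ∘ fun v : ZMod n => v + k) = id := funext fun u => by simp
  rw [e, Sym2.map_id, Set.image_id]

theorem trianglesAt_add_of_rotate_eq [NeZero n] {k : ZMod n} (h : rotate k T = T) (v : ZMod n) :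
    trianglesAt T (v + k) = trianglesAt T v := by
  refine le_antisymm ?_ (trianglesAt_le_of_rotate_eq h v)
  have := trianglesAt_le_of_rotate_eq (rotate_neg_eq h) (v + k)
  rwa [add_neg_cancel_right] at this

/-! ### Recovering the triangulation from the weights of chords. -/

variable {G : ℤ → ℤ → ℤ}

theorem IsTriangulation.abs_kernel [NeZero n] (hT : IsTriangulation T)
    (hG : IsKernel (fun v : ℤ => (trianglesAt T (v : ZMod n) : ℤ)) G) {u v : ZMod n}
    (h : s(u, v) ∈ T) : |G u.val v.val| = 1 := by
  rcases lt_trichotomy u.val v.val with huv | huv | huv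
  · rw [hT.kernel_edge hG huv (Or.inr h), abs_one]
  · exact absurd (ZMod.val_injective n huv) (hT.prop.1 _ h).1
  · rw [hG.skew v.val, abs_neg, hT.kernel_edge hG huv (IsEdge.symm (Or.inr h)), abs_one]

/-- Chords of weight `1` do not cross. -/
theorem IsKernel.not_alternate [NeZero n] {q : ℤ → ℤ} (hG : IsKernel q G)
    (hpos : ∀ i j : ℤ, i < j → j < i + n → 0 < G i j) {a b c d : ZMod n}
    (hab : a.val < b.val) (hbc : b.val < c.val) (hcd : c.val < d.val)
    (hac : |G a.val c.val| = 1) (hbd : |G b.val d.val| = 1) : False := by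
  have hd := d.val_lt
  have pos : ∀ {u v : ZMod n}, u.val < v.val → 0 < G u.val v.val := fun {u v} huv =>
    hpos _ _ (by omega) (by have := v.val_lt; omega)
  rw [abs_of_pos (pos (by omega))] at hac hbd
  have e := hG.ptolemy a.val b.val c.val d.val
  rw [hac, hbd] at e
  have h1 := mul_pos (pos hab) (pos hcd)
  have h2 := mul_pos (pos (hab.trans (hbc.trans hcd))) (pos hbc)
  omega

theorem IsTriangulation.rotate_eq [NeZero n] (hT : IsTriangulation T)
    (hG : IsKernel (fun v : ℤ => (trianglesAt T (v : ZMod n) : ℤ)) G)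
    (hpos : ∀ i j : ℤ, i < j → j < i + n → 0 < G i j)
    (h0 : ∀ i, G i (i + n) = 0) (h1 : ∀ i, G i (i + n - 1) = 1) {k : ℤ}
    (hk : ∀ v : ℤ, trianglesAt T ((v + k : ℤ) : ZMod n) = trianglesAt T (v : ZMod n)) :
    rotate (k : ZMod n) T = T := by
  have hinj : Function.Injective fun u : ZMod n => u + (k : ZMod n) := add_left_injective _
  -- Representatives may wrap around under the rotation, so only the weight `|G|`, not `G` itself,
  -- is compared.
  have hdvd : ∀ u : ZMod n, (n : ℤ) ∣ ((u + (k : ZMod n)).val : ℤ) - (u.val + k) := fun u => by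
    rw [← ZMod.intCast_eq_intCast_iff_dvd_sub]
    simp
  have habs : ∀ u v : ZMod n, s(u, v) ∈ T →
      |G (u + (k : ZMod n)).val (v + (k : ZMod n)).val| = 1 := fun u v huv => by
    rw [hG.abs_congr h0 h1 (hdvd u) (hdvd v), hG.translate (fun v => by rw [hk]),
      hT.abs_kernel hG huv]
  have hsub : rotate (k : ZMod n) T ⊆ T := by
    rintro _ ⟨e, he, rfl⟩
    induction e with
    | _ u v =>
    rw [Sym2.map_mk]
    have hd := hT.prop.1 _ he
    have habs' : ∀ a c : ZMod n, s(u + (k : ZMod n), v + (k : ZMod n)) = s(a, c) →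
        |G a.val c.val| = 1 := fun a c hac => by
      rcases Sym2.eq_iff.mp hac with ⟨rfl, rfl⟩ | ⟨rfl, rfl⟩
      · exact habs u v he
      · exact habs v u (by rwa [Sym2.eq_swap])
    refine hT.mem_of_not_crosses ⟨?_, ?_⟩ ?_
    · rw [Sym2.mk_isDiag_iff]
      exact fun h => hd.1 (hinj h)
    · rintro ⟨i, hi⟩
      refine hd.2 ⟨i - k, Sym2.map.injective hinj ?_⟩
      simp only [Sym2.map_mk, hi]
      rw [sub_add_cancel, show i - (k : ZMod n) + 1 + k = i + 1 by ring]
    · rintro f hf ⟨a, b, c, d, hab, hbc, hcd, ⟨h, rfl⟩ | ⟨h, rfl⟩⟩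
      · exact hG.not_alternate hpos hab hbc hcd (habs' _ _ h) (hT.abs_kernel hG hf)
      · exact hG.not_alternate hpos hab hbc hcd (hT.abs_kernel hG hf) (habs' _ _ h)
  -- The rotated set has as many elements as the finite set `T`, so inclusion is equality.
  refine Set.eq_of_subset_of_ncard_le hsub ?_
  exact (Set.ncard_image_of_injective T (Sym2.map.injective hinj)).ge

end Rotation

/-- The natural periods of a sequence are the multiples of the least one. -/
theorem dvd_of_isLeast_period {q : ℤ → ℤ} {d : ℕ}
    (hd : IsLeast {k : ℕ | 0 < k ∧ ∀ v : ℤ, q (v + k) = q v} d) {m : ℕ}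
    (hm : ∀ v : ℤ, q (v + m) = q v) : d ∣ m := by
  have hper : Function.Periodic q (d : ℤ) := hd.1.2
  by_contra hnd
  have hpos : 0 < m % d := Nat.pos_of_ne_zero fun h => hnd (Nat.dvd_of_mod_eq_zero h)
  refine absurd (hd.2 ⟨hpos, fun v => ?_⟩) (not_le.mpr (Nat.mod_lt _ hd.1.1))
  have h := (hper.int_mul (m / d : ℕ)) (v + (m % d : ℕ))
  rw [← h, ← hm v]
  congr 1
  have := Nat.mod_add_div m d
  have : ((m % d : ℕ) : ℤ) + d * (m / d : ℕ) = m := by exact_mod_cast this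
  linear_combination this

theorem IsKernel.isMinimalQuiddityPeriod_iff {q : ℤ → ℤ} {G : ℤ → ℤ → ℤ} (hG : IsKernel q G)
    (d : ℕ) : IsMinimalQuiddityPeriod G d ↔
      IsLeast {k : ℕ | 0 < k ∧ ∀ v : ℤ, q (v + k) = q v} d := by
  have hq : ∀ i : ℤ, G i (i + 2) = q (i + 1) := fun i => by
    rw [← hG.quiddity, add_sub_cancel_right, add_assoc, one_add_one_eq_two]
  have : {k : ℕ | 0 < k ∧ ∀ i : ℤ, G (i + k) (i + k + 2) = G i (i + 2)} =
      {k : ℕ | 0 < k ∧ ∀ v : ℤ, q (v + k) = q v} := by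
    ext k
    refine and_congr_right fun _ => ⟨fun h v => ?_, fun h i => ?_⟩
    · have := h (v - 1)
      rwa [hq, hq, sub_add_cancel, show v - 1 + (k : ℤ) + 1 = v + k by ring] at this
    · rw [hq, hq, ← h (i + 1), add_right_comm]
  rw [IsMinimalQuiddityPeriod, this]

/-- If the quiddity row has period `d` and `n = d * k`, then `k ≤ 3`, and `k` determines the trace
of the monodromy. -/
theorem IsKernel.trace_eq {q : ℤ → ℤ} {G : ℤ → ℤ → ℤ} {n d k : ℕ} (hG : IsKernel q G)
    (hpos : ∀ i j : ℤ, i < j → j < i + n → 0 < G i j)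
    (h0 : ∀ i, G i (i + n) = 0) (h1 : ∀ i, G i (i + n - 1) = 1)
    (hd : 0 < d) (hk : 0 < k) (hn : n = d * k) (hq : ∀ v, q (v + d) = q v) :
    (k = 1 ∧ G 0 (0 + d + 1) - G (0 + 1) (0 + d) = -2) ∨
    (k = 2 ∧ G 0 (0 + d + 1) - G (0 + 1) (0 + d) = 0) ∨
    (k = 3 ∧ G 0 (0 + d + 1) - G (0 + 1) (0 + d) = 1) := by
  rcases Nat.lt_or_ge 1 k with hk1 | hk1
  · right
    refine first_return (g := fun j => G 0 (j * d)) hk1 (by simp [hG.self]) (fun j => ?_) ?_ ?_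
    · have := hG.cayley_hamilton hq 0 (j * d)
      convert this using 3
      · push_cast
        ring
      · push_cast
        ring_nf
    · have := h0 0
      rw [zero_add, hn] at this
      push_cast at this
      rwa [mul_comm (d : ℤ)] at this
    · intro j hj hjk
      have e1 : 0 < j * d := by positivity
      have e2 : j * d < n := by
        rw [hn, mul_comm d]
        exact Nat.mul_lt_mul_of_pos_right hjk hd
      exact hpos _ _ (by exact_mod_cast e1) (by rw [zero_add]; exact_mod_cast e2)
  · left
    obtain rfl : k = 1 := by omega
    obtain rfl : n = d := by rw [hn, mul_one]
    refine ⟨rfl, ?_⟩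
    -- Here `d = n`, and the trace is `G 0 (n + 1) - G 1 n = -1 - 1`.
    have e1 := hG.antiperiodic_right h0 h1 0 1
    have e2 := hG.top_one 0
    have e3 := h1 1
    rw [zero_add] at e2
    rw [add_sub_cancel_left] at e3
    rw [zero_add, zero_add, e3, add_comm, e1, e2]
    norm_num

end Frieze

theorem mainTheorem7 (n : ℕ) (hn : 3 ≤ n) (F : ℤ → ℤ → ℤ)
    (hF : Frieze.IsFinitePattern n F) (hpos : Frieze.IsPositive n F)
    (T : Set (Sym2 (ZMod n))) (hT : Frieze.IsTriangulation T)
    (hFT : Frieze.IsAssociatedTo F T) :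
    ∃ G : ℤ → ℤ → ℤ,
      Frieze.IsTameExtension n F G ∧
      (∀ G' : ℤ → ℤ → ℤ, Frieze.IsTameExtension n F G' →
        ∀ i j : ℤ, i ≤ j → G' i j = G i j) ∧
      ∃ s : ℤ, Frieze.IsPrincipalGrowthCoefficient G s ∧
        (s = -2 ∨ s = 0 ∨ s = 1) ∧
        (s = -2 ↔ Frieze.HasNoRotationalSymmetry T) ∧
        (s = 0 ↔ Frieze.HasFoldSymmetry 2 T) ∧
        (s = 1 ↔ Frieze.HasFoldSymmetry 3 T) := by
  have : NeZero n := ⟨by omega⟩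
  set q : ℤ → ℤ := fun v => (Frieze.trianglesAt T (v : ZMod n) : ℤ) with hq
  obtain ⟨G, hG⟩ := Frieze.exists_isKernel q
  have hext := hG.extend hF hpos hFT
  have hGpos : ∀ i j : ℤ, i < j → j < i + n → 0 < G i j := fun i j h1 h2 => by
    rw [hext i j h1.le h2.le]
    exact hpos i j h1 h2
  have h0 : ∀ i, G i (i + n) = 0 := fun i => by
    rw [hext i _ (by omega) le_rfl, hF.bottom_zero]
  have h1 : ∀ i, G i (i + n - 1) = 1 := fun i => by
    rw [hext i _ (by omega) (by omega), hF.bottom_one]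
  refine ⟨G, ⟨hG.isInfinitePattern, hG.isTame, hext⟩, fun G' hG' =>
    hG.unique hG'.infinite hG'.tame fun v => ?_, ?_⟩
  · rw [hG'.extend _ _ (by omega) (by omega), hFT v]
  have hqn : ∀ v, q (v + n) = q v := fun v => by simp [hq]
  obtain ⟨d, hd⟩ : ∃ d, IsLeast {k : ℕ | 0 < k ∧ ∀ v : ℤ, q (v + k) = q v} d := by
    classical
    have hex : ∃ k : ℕ, 0 < k ∧ ∀ v : ℤ, q (v + k) = q v := ⟨n, by omega, hqn⟩
    exact ⟨Nat.find hex, Nat.find_spec hex, fun m hm => Nat.find_min' hex hm⟩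
  obtain ⟨k, hk⟩ := Frieze.dvd_of_isLeast_period hd hqn
  have hd0 := hd.1.1
  have hk0 : 0 < k := Nat.pos_of_ne_zero (by rintro rfl; omega)
  have hrot : ∀ m : ℕ, Frieze.rotate (m : ZMod n) T = T ↔ d ∣ m := fun m => by
    refine ⟨fun h => Frieze.dvd_of_isLeast_period hd fun v => ?_, ?_⟩
    · have := Frieze.trianglesAt_add_of_rotate_eq h (v : ZMod n)
      simp [hq, this]
    · rintro ⟨c, rfl⟩
      have hper : Function.Periodic q ((c : ℤ) * d) :=
        Function.Periodic.int_mul (f := q) (c := (d : ℤ)) hd.1.2 c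
      have := hT.rotate_eq hG hGpos h0 h1 (k := (c : ℤ) * d) fun v =>
        Int.ofNat_inj.mp (hper v)
      rw [← this]
      congr 1
      push_cast
      rw [mul_comm]
  have hno : Frieze.HasNoRotationalSymmetry T ↔ k = 1 := by
    constructor
    · intro h
      -- Rotation by `d` is a symmetry, so it is trivial and `n ∣ d`; this forces `k = 1`.
      have hz := h (d : ZMod n) ((hrot d).mpr dvd_rfl)
      rw [ZMod.natCast_eq_zero_iff] at hz
      have := Nat.le_of_dvd hd0 hz
      nlinarith
    · rintro rfl c hc
      rw [← ZMod.natCast_zmod_val c, hrot] at hc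
      rw [mul_one] at hk
      rw [← ZMod.natCast_zmod_val c, ZMod.natCast_eq_zero_iff]
      exact (dvd_of_eq hk).trans hc
  have hfold : ∀ p : ℕ, Frieze.HasFoldSymmetry p T ↔ p ∣ k := fun p => by
    constructor
    · rintro ⟨m, hm, hr⟩
      obtain ⟨c, rfl⟩ := (hrot m).mp hr
      refine ⟨c, Nat.eq_of_mul_eq_mul_left hd0 ?_⟩
      rw [← hk, hm]
      ring
    · rintro ⟨c, rfl⟩
      exact ⟨d * c, by rw [hk]; ring, (hrot _).mpr (dvd_mul_right d c)⟩
  refine ⟨G 0 (0 + d + 1) - G (0 + 1) (0 + d),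
    ⟨d, (hG.isMinimalQuiddityPeriod_iff d).mpr hd, fun i => hG.trace_const hd.1.2 i⟩, ?_⟩
  rw [hno, hfold, hfold]
  -- With `k` equal to `1`, `2` or `3`, the conditions `k = 1`, `2 ∣ k`, `3 ∣ k` separate the three
  -- cases.
  rcases hG.trace_eq hGpos h0 h1 hd0 hk0 hk hd.1.2 with ⟨rfl, h⟩ | ⟨rfl, h⟩ | ⟨rfl, h⟩ <;>
    rw [h] <;> norm_num
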